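/- All rings are commutative with identity. A ring is arithmetical if its ideals form a distributive lattice, that is, $(\mathfrak a+\mathfrak b)\cap\mathfrak c=(\mathfrak a\cap\mathfrak c)+(\mathfrak b\cap\mathfrak c)$ for all ideals $\mathfrak a,\mathfrak b,\mathfrak c$. For $n,d\ge 0$, a module $E$ over a ring $A$ is $n$-presented if there is an exact sequence $F_n\to F_{n-1}\to\cdots\to F_0\to E\to 0$ of $A$-modules with every $F_i$ free of finite rank, and $A$ is an $(n,d)$-ring if every $n$-presented $A$-module has projective dimension at most $d$ over $A$. For a ring $B$ and $x\in B$, $x$ is a zero-divisor if $xy=0$ for some $y\neq 0$ in $B$, and $(0:x)=\{y\in B: yx=0\}$. **Proposition 3.8.** Let $A$ be an arithmetical ring. (1) Suppose that for every maximal ideal $\mathfrak m$ of $A$ and every nonzero zero-divisor $x$ of the localization $A_{\mathfrak m}$, the ideal $(0:x)$ of $A_{\mathfrak m}$ is not finitely generated. Then $A$ is a $(3,1)$-ring. (2) If there are a maximal ideal $\mathfrak m$ of $A$ and a nonzero zero-divisor $x$ of $A_{\mathfrak m}$ such that the ideal $(0:x)$ of $A_{\mathfrak m}$ is finitely generated,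 then $A$ is not a $(1,d)$-ring for any integer $d\ge 0$. -/

import Mathlib

open CategoryTheory

universe u

/-- A commutative ring is arithmetical if its ideals form a distributive lattice. -/
def IsArithmeticalRing (A : Type u) [CommRing A] : Prop :=
  ∀ a b c : Ideal A, (a ⊔ b) ⊓ c = (a ⊓ c) ⊔ (b ⊓ c)

/-- `E` is `n`-presented: there is an exact sequence
`F_n → F_{n-1} → ⋯ → F_1 → F_0 → E → 0` with every `F_i = A ^ (r i)` free of finite rank.
The map `f i : F_{i+1} → F_i` belongs to the sequence when `i < n`; nothing is required of the
other ones. -/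
def IsNPresented (A : Type u) [CommRing A] (n : ℕ) (E : Type u) [AddCommGroup E] [Module A E] :
    Prop :=
  ∃ (r : ℕ → ℕ) (f : ∀ i : ℕ, (Fin (r (i + 1)) → A) →ₗ[A] (Fin (r i) → A))
    (g : (Fin (r 0) → A) →ₗ[A] E),
    Function.Surjective g ∧
    (0 < n → Function.Exact (f 0) g) ∧
    (∀ i : ℕ, i + 1 < n → Function.Exact (f (i + 1)) (f i))

/-- `A` is an `(n, d)`-ring: every `n`-presented `A`-module has projective dimension at most `d`. -/
def IsNDRing (A : Type u) [CommRing A] (n d : ℕ) : Prop :=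
  ∀ (E : Type u) [AddCommGroup E] [Module A E],
    IsNPresented A n E → projectiveDimension (ModuleCat.of A E) ≤ d

/-- `x` is a zero-divisor: it is killed by some nonzero element. -/
def IsZeroDivisor {B : Type u} [CommRing B] (x : B) : Prop :=
  ∃ y : B, y ≠ 0 ∧ x * y = 0

/-- The ideal `(0 : x) = {y | y * x = 0}`. -/
def annIdeal {B : Type u} [CommRing B] (x : B) : Ideal B :=
  (Ideal.span {x}).annihilator

/-! Both parts reduce to the localizations `R` at maximal ideals, which are chain rings. (1) A
syzygy that is finitely presented inside a free module localizes to such a module over `R`. There a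
cyclic summand `R / (0 : a)` splits off; finite presentation makes `(0 : a)` finitely generated, so
the summand is free or zero, and induction on the rank gives projectivity
(`PreValuationRing.projective_of_injective_pi`). (2) A finitely generated `(0 : x)` is some `(y)`,
and then `(0 : y) = (x)`. So `R / (x)` has a periodic resolution that never becomes projective, and
it is a localization of a finitely presented `A`-module. -/

/-- A fraction is associated to its numerator. -/
lemma IsLocalization.associated_mk'_algebraMap {A B : Type*} [CommRing A] [CommRing B]
    [Algebra A B] {S : Submonoid A} [IsLocalization S B] (a : A) (s : S) :
    Associated (IsLocalization.mk' B a s) (algebraMap A B a) :=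
  ⟨(IsLocalization.map_units B s).unit, IsLocalization.mk'_spec B a s⟩

namespace IsArithmeticalRing

variable {A : Type u} [CommRing A]

/-- In an arithmetical ring, any two elements become comparable under divisibility after
multiplication by complementary elements `s` and `1 - s`. -/
lemma exists_dvd_mul (hA : IsArithmeticalRing A) (a b : A) :
    ∃ s : A, a ∣ s * b ∧ b ∣ (1 - s) * a := by
  -- Distributivity splits `a = b + (a - b)` into a multiple of `b` and a multiple `(a - b) * s`
  -- lying in `(a)`; the latter forces `a ∣ s * b`.
  have h := hA (Ideal.span {b}) (Ideal.span {a - b}) (Ideal.span {a})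
  have ha : a ∈ (Ideal.span {b} ⊔ Ideal.span {a - b}) ⊓ Ideal.span {a} := by
    refine ⟨?_, Ideal.mem_span_singleton_self a⟩
    exact Submodule.mem_sup.2 ⟨b, Ideal.mem_span_singleton_self b, a - b,
      Ideal.mem_span_singleton_self _, by ring⟩
  rw [h] at ha
  obtain ⟨t, ⟨ht, -⟩, w, ⟨hw, hw'⟩, htw⟩ := Submodule.mem_sup.1 ha
  obtain ⟨t', rfl⟩ := Ideal.mem_span_singleton.1 ht
  obtain ⟨s, rfl⟩ := Ideal.mem_span_singleton.1 hw
  obtain ⟨c, hc⟩ := Ideal.mem_span_singleton.1 hw'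
  exact ⟨s, ⟨s - c, by linear_combination -hc⟩, ⟨t' - s, by linear_combination -htw⟩⟩

/-- The localizations of an arithmetical ring at its primes are chain rings. -/
lemma preValuationRing_localization (hA : IsArithmeticalRing A) (p : Ideal A) [p.IsPrime] :
    PreValuationRing (Localization.AtPrime p) := by
  refine PreValuationRing.iff_dvd_total.2 ⟨fun x y ↦ ?_⟩
  obtain ⟨a, s, rfl⟩ := IsLocalization.exists_mk'_eq p.primeCompl x
  obtain ⟨b, t, rfl⟩ := IsLocalization.exists_mk'_eq p.primeCompl y
  rw [(IsLocalization.associated_mk'_algebraMap a s).dvd_iff_dvd_left,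
    (IsLocalization.associated_mk'_algebraMap b t).dvd_iff_dvd_right,
    (IsLocalization.associated_mk'_algebraMap b t).dvd_iff_dvd_left,
    (IsLocalization.associated_mk'_algebraMap a s).dvd_iff_dvd_right]
  obtain ⟨r, h₁, h₂⟩ := hA.exists_dvd_mul a b
  have unit_of (u : A) (hu : u ∉ p) : IsUnit (algebraMap A (Localization.AtPrime p) u) :=
    IsLocalization.map_units _ (⟨u, hu⟩ : p.primeCompl)
  by_cases hr : r ∈ p
  · right
    have hr' : 1 - r ∉ p := fun h ↦
      (Ideal.ne_top_iff_one p).1 (Ideal.IsPrime.ne_top ‹_›) (by simpa using p.add_mem h hr)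
    have := map_dvd (algebraMap A (Localization.AtPrime p)) h₂
    rwa [map_mul, (unit_of _ hr').dvd_mul_left] at this
  · left
    have := map_dvd (algebraMap A (Localization.AtPrime p)) h₁
    rwa [map_mul, (unit_of _ hr).dvd_mul_left] at this

end IsArithmeticalRing

lemma mem_annIdeal {B : Type u} [CommRing B] {x y : B} : y ∈ annIdeal x ↔ y * x = 0 := by
  rw [annIdeal, Submodule.mem_annihilator_span_singleton, smul_eq_mul]

/-! ### Finitely presented submodules of free modules over a chain ring -/

section ChainRing

variable {R : Type u} [CommRing R]

/-- Over a chain ring, a finitely generated ideal is principal. -/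
lemma PreValuationRing.exists_eq_span_singleton [PreValuationRing R] {I : Ideal R} (hI : I.FG) :
    ∃ a, I = Ideal.span {a} := by
  induction I, hI using Submodule.fg_induction with
  | singleton x => exact ⟨x, rfl⟩
  | sup I J _ _ hI hJ =>
    rcases (PreValuationRing.iff_ideal_total.1 ‹_›).total I J with h | h
    · rwa [sup_eq_right.2 h]
    · rwa [sup_eq_left.2 h]

/-- A finitely presented submodule of a free module of finite rank over a chain ring is
projective, if no nonzero zero-divisor has a finitely generated annihilator. -/
lemma PreValuationRing.projective_of_injective_pi [PreValuationRing R]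
    (hR : ∀ x : R, x ≠ 0 → IsZeroDivisor x → ¬ (annIdeal x).FG) (n : ℕ) (M : Type u)
    [AddCommGroup M] [Module R M] [Module.FinitePresentation R M] (φ : M →ₗ[R] (Fin n → R))
    (hφ : Function.Injective φ) : Module.Projective R M := by
  induction n generalizing M with
  | zero =>
    have : Subsingleton M := hφ.subsingleton
    infer_instance
  | succ n ih =>
    let I (j : Fin (n + 1)) : Ideal R := LinearMap.range (LinearMap.proj j ∘ₗ φ)
    have : @Std.Total (Ideal R) (· ≤ ·) := PreValuationRing.iff_ideal_total.1 ‹_›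
    -- Take the coordinate with the largest image: every coordinate of `φ v` is then a multiple of
    -- `a`, so `(0 : a)` kills `v` and `M = ker ℓ ⊕ R v`.
    obtain ⟨i, hi⟩ : ∃ i, ∀ j, I j ≤ I i := by
      obtain ⟨_, ⟨i, rfl⟩, hmax⟩ := (Set.finite_range I).exists_maximal (Set.range_nonempty I)
      exact ⟨i, fun j ↦ (this.total (I j) (I i)).elim id (hmax ⟨j, rfl⟩)⟩
    let ℓ : M →ₗ[R] R := LinearMap.proj i ∘ₗ φ
    obtain ⟨a, ha⟩ : ∃ a, I i = Ideal.span {a} :=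
      PreValuationRing.exists_eq_span_singleton
        (Module.Finite.iff_fg.1 (Module.Finite.range ℓ))
    obtain ⟨v, hv⟩ : a ∈ I i := ha ▸ Ideal.mem_span_singleton_self a
    replace hv : ℓ v = a := hv
    have ann_v (c : R) (hc : c * a = 0) : c • v = 0 := by
      apply hφ
      ext j
      obtain ⟨t, ht⟩ := Ideal.mem_span_singleton.1 (ha.le (hi j ⟨v, rfl⟩))
      replace ht : φ v j = a * t := ht
      simp [ht, ← mul_assoc, hc]
    have dvd_ℓ (w : M) : ∃ c, ℓ w = c * a := by
      obtain ⟨c, hc⟩ := Ideal.mem_span_singleton.1 (ha.le (⟨w, rfl⟩ : ℓ w ∈ I i))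
      exact ⟨c, by rw [hc, mul_comm]⟩
    let K := LinearMap.ker ℓ
    let V := Submodule.span R {v}
    have hKV : IsCompl K V := by
      constructor
      · rw [Submodule.disjoint_def]
        intro w hw hwV
        obtain ⟨c, rfl⟩ := Submodule.mem_span_singleton.1 hwV
        exact ann_v c (by simpa [K, hv] using hw)
      · rw [codisjoint_iff, eq_top_iff]
        intro w _
        obtain ⟨c, hc⟩ := dvd_ℓ w
        exact Submodule.mem_sup.2 ⟨w - c • v, by simp [K, hv, hc], c • v,
          Submodule.mem_span_singleton.2 ⟨c, rfl⟩, by simp⟩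
    let e := Submodule.prodEquivOfIsCompl K V hKV
    have : Module.FinitePresentation R (K × V) := .of_equiv e.symm
    have : Module.Finite R K := .of_surjective _ (LinearMap.fst_surjective (R := R) (M₂ := V))
    have : Module.Finite R V := .of_surjective _ (LinearMap.snd_surjective (R := R) (M := K))
    have : Module.FinitePresentation R K :=
      Module.finitePresentation_of_surjective (LinearMap.fst R K V) LinearMap.fst_surjective
        (by rw [LinearMap.ker_fst, ← Module.Finite.iff_fg]; exact .range _)
    have : Module.FinitePresentation R V :=
      Module.finitePresentation_of_surjective (LinearMap.snd R K V) LinearMap.snd_surjective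
        (by rw [LinearMap.ker_snd, ← Module.Finite.iff_fg]; exact .range _)
    have : Module.Projective R K := by
      -- Coordinate `i` vanishes on `K`, so dropping it keeps the map injective.
      refine ih K (LinearMap.funLeft R R i.succAbove ∘ₗ φ ∘ₗ K.subtype) ?_
      rw [injective_iff_map_eq_zero]
      intro w hw
      apply Subtype.ext
      apply hφ
      ext j
      rcases Fin.eq_self_or_eq_succAbove i j with rfl | ⟨j, rfl⟩
      · rw [ZeroMemClass.coe_zero, map_zero]
        exact w.2
      · simpa [LinearMap.funLeft] using congr_fun hw j
    have : Module.Projective R V := by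
      let q : R →ₗ[R] V := LinearMap.toSpanSingleton R V ⟨v, Submodule.mem_span_singleton_self v⟩
      have hq : Function.Surjective q := by
        rintro ⟨w, hw⟩
        obtain ⟨c, rfl⟩ := Submodule.mem_span_singleton.1 hw
        exact ⟨c, rfl⟩
      have hker : LinearMap.ker q = annIdeal a := by
        ext c
        rw [mem_annIdeal, LinearMap.mem_ker, Subtype.ext_iff]
        refine ⟨fun h ↦ ?_, ann_v c⟩
        replace h : c • v = 0 := h
        simpa [hv] using congr_arg ℓ h
      have hfg : (annIdeal a).FG := hker ▸ Module.FinitePresentation.fg_ker q hq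
      by_cases ha0 : a = 0
      · have : Subsingleton V := by
          have : v = 0 := by simpa using ann_v 1 (by simp [ha0])
          simp [V, this]
          infer_instance
        infer_instance
      · refine .of_equiv (LinearEquiv.ofBijective q ⟨LinearMap.ker_eq_bot.1 ?_, hq⟩)
        rw [hker, eq_bot_iff]
        intro c hc
        by_contra hc0
        exact hR a ha0 ⟨c, hc0, by rw [mul_comm, mem_annIdeal.1 hc]⟩ hfg
    exact .of_equiv e

end ChainRing

/-- The first syzygy of a `2`-presented module is finitely presented. -/
lemma Module.finitePresentation_ker_of_exact {A : Type u} [CommRing A] {r₀ r₁ r₂ : ℕ}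
    {E : Type u} [AddCommGroup E] [Module A E] {f₁ : (Fin r₂ → A) →ₗ[A] (Fin r₁ → A)}
    {f₀ : (Fin r₁ → A) →ₗ[A] (Fin r₀ → A)} {g : (Fin r₀ → A) →ₗ[A] E}
    (h₀ : Function.Exact f₀ g) (h₁ : Function.Exact f₁ f₀) :
    Module.FinitePresentation A (LinearMap.ker g) := by
  have hmem (x) : f₀ x ∈ LinearMap.ker g := h₀.apply_apply_eq_zero x
  refine Module.finitePresentation_of_surjective (f₀.codRestrict (LinearMap.ker g) hmem) ?_ ?_
  · rintro ⟨y, hy⟩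
    obtain ⟨x, rfl⟩ := (h₀ y).1 hy
    exact ⟨x, rfl⟩
  · rw [LinearMap.ker_codRestrict, h₁.linearMap_ker_eq, ← Module.Finite.iff_fg]
    exact .range _

/-- A module is of projective dimension at most one if it has a projective first syzygy. -/
lemma ModuleCat.hasProjectiveDimensionLE_one_of_projective_ker {A : Type u} [CommRing A]
    {P E : Type u} [AddCommGroup P] [Module A P] [AddCommGroup E] [Module A E]
    [Module.Projective A P] (g : P →ₗ[A] E) (hg : Function.Surjective g)
    [Module.Projective A (LinearMap.ker g)] :
    HasProjectiveDimensionLE (ModuleCat.of A E) 1 := by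
  have hS := LinearMap.shortExact_shortComplexKer hg
  have : Projective g.shortComplexKer.X₂ :=
    (IsProjective.iff_projective P).1 inferInstance
  have : Projective g.shortComplexKer.X₁ :=
    (IsProjective.iff_projective (LinearMap.ker g)).1 inferInstance
  exact (hS.hasProjectiveDimensionLT_X₃_iff 0 inferInstance).2 inferInstance

/-- Projectivity of the finitely presented first syzygy can be checked at maximal ideals, and
localization preserves its embedding in a free module. -/
lemma IsArithmeticalRing.isNDRing_three_one {A : Type u} [CommRing A] (hA : IsArithmeticalRing A)
    (h : ∀ (m : Ideal A) [m.IsMaximal] (x : Localization.AtPrime m),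
      x ≠ 0 → IsZeroDivisor x → ¬ (annIdeal x).FG) : IsNDRing A 3 1 := by
  rintro E _ _ ⟨r, f, g, hg, h₀, hf⟩
  have := Module.finitePresentation_ker_of_exact (h₀ (by norm_num)) (hf 0 (by norm_num))
  have : Module.Projective A (LinearMap.ker g) := by
    refine Module.projective_of_localization_maximal fun m hm ↦ ?_
    have := hA.preValuationRing_localization m
    let ι : (Fin (r 0) → A) →ₗ[A] (Fin (r 0) → Localization.AtPrime m) :=
      .pi fun i ↦ Algebra.linearMap A (Localization.AtPrime m) ∘ₗ .proj i
    refine PreValuationRing.projective_of_injective_pi (h m) (r 0) _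
      (IsLocalizedModule.mapExtendScalars m.primeCompl
        (LocalizedModule.mkLinearMap m.primeCompl (LinearMap.ker g)) ι
        (Localization.AtPrime m) (LinearMap.ker g).subtype) ?_
    exact IsLocalizedModule.map_injective m.primeCompl _ ι _ (Submodule.subtype_injective _)
  have := ModuleCat.hasProjectiveDimensionLE_one_of_projective_ker g hg
  exact (projectiveDimension_le_iff _ 1).2 this

/-! ### Periodic resolutions over local rings -/

section Periodic

variable {R : Type u} [CommRing R]

/-- In a local chain ring, `(0 : x) = (y)` with `x, y` nonzero implies `(0 : y) = (x)`. -/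
lemma PreValuationRing.annIdeal_eq_span_of_annIdeal_eq_span [IsLocalRing R] [PreValuationRing R]
    {x y : R} (hx : x ≠ 0) (hy : y ≠ 0) (h : annIdeal x = Ideal.span {y}) :
    annIdeal y = Ideal.span {x} := by
  have hyx : y * x = 0 := mem_annIdeal.1 (h ▸ Ideal.mem_span_singleton_self y)
  refine le_antisymm (fun z hz ↦ ?_) ?_
  · rw [mem_annIdeal] at hz
    rw [Ideal.mem_span_singleton]
    rcases ValuationRing.dvd_total x z with hxz | ⟨t, rfl⟩
    · exact hxz
    by_cases ht : IsUnit t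
    · exact ht.mul_right_dvd.2 dvd_rfl
    exfalso
    -- Here `x = z * t` with `t` a nonunit and `z * y = 0`. If `y = t * w`, then `w` kills `x`, so
    -- `w ∈ (y) = (t * w)` and `w = 0`; if `y ∣ t`, then `x = 0`.
    rcases ValuationRing.dvd_total t y with ⟨w, rfl⟩ | ⟨s, rfl⟩
    · have hw : w ∈ annIdeal (z * t) := mem_annIdeal.2 (by linear_combination hz)
      rw [h, Ideal.mem_span_singleton] at hw
      obtain ⟨v, hv⟩ := hw
      have hu : IsUnit (1 - t * v) := IsLocalRing.isUnit_one_sub_self_of_mem_nonunits _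
        fun h ↦ ht (isUnit_of_mul_isUnit_left h)
      have hw0 : w = 0 := (hu.mul_left_eq_zero).1 (by linear_combination hv)
      exact hy (by rw [hw0, mul_zero])
    · exact hx (by linear_combination s * hz)
  · rw [Ideal.span_singleton_le_iff_mem, mem_annIdeal, mul_comm, hyx]

/-- If `(0 : x) = (y)` and `(0 : y) = (x)` with `x, y` nonzero in a local ring, then `R ⧸ (x)`
has infinite projective dimension. -/
lemma ModuleCat.not_hasProjectiveDimensionLE_of_annIdeal_eq_span [IsLocalRing R] (d : ℕ) {x y : R}
    (hx : x ≠ 0) (hy : y ≠ 0) (hxy : annIdeal x = Ideal.span {y})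
    (hyx : annIdeal y = Ideal.span {x}) {N : Type u} [AddCommGroup N] [Module R N]
    (g : R →ₗ[R] N) (hg : Function.Surjective g) (hker : LinearMap.ker g = Ideal.span {x}) :
    ¬ HasProjectiveDimensionLE (ModuleCat.of R N) d := by
  induction d generalizing x y N with
  | zero =>
    intro hN
    rw [← projective_iff_hasProjectiveDimensionLE_zero] at hN
    have : Module.Projective R N := (IsProjective.iff_projective N).2 hN
    -- For a section `l`, the element `l (g 1)` kills `x` and is `1` modulo the nonunit `x`, hence
    -- is a unit.
    obtain ⟨l, hl⟩ := Module.projective_lifting_property g LinearMap.id hg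
    have hgx : g x = 0 := LinearMap.mem_ker.1 (hker ▸ Ideal.mem_span_singleton_self x)
    have hxe : x * l (g 1) = 0 := by
      rw [← smul_eq_mul, ← map_smul, ← map_smul, smul_eq_mul, mul_one, hgx, map_zero]
    have he : 1 - l (g 1) ∈ LinearMap.ker g := by
      rw [LinearMap.mem_ker, map_sub, sub_eq_zero]
      exact (LinearMap.congr_fun hl (g 1)).symm
    rw [hker] at he
    obtain ⟨c, hc⟩ := Ideal.mem_span_singleton.1 he
    have hxu : ¬ IsUnit x := fun hu ↦ hy <| by
      have : y * x = 0 := mem_annIdeal.1 (hxy ▸ Ideal.mem_span_singleton_self y)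
      exact (hu.mul_left_eq_zero).1 this
    have hu : IsUnit (l (g 1)) := by
      refine (IsLocalRing.isUnit_or_isUnit_one_sub_self (l (g 1))).resolve_right fun h ↦ hxu ?_
      rw [hc] at h
      exact isUnit_of_mul_isUnit_left h
    exact hx ((hu.mul_left_eq_zero).1 hxe)
  | succ d ih =>
    intro hN
    have hS := LinearMap.shortExact_shortComplexKer hg
    have : Projective g.shortComplexKer.X₂ :=
      (IsProjective.iff_projective R).1 inferInstance
    have hK : HasProjectiveDimensionLE (ModuleCat.of R (LinearMap.ker g)) d :=
      (hS.hasProjectiveDimensionLT_X₃_iff d inferInstance).1 hN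
    have hxK : x ∈ LinearMap.ker g := hker ▸ Ideal.mem_span_singleton_self x
    -- The syzygy `(x)` is `R / (0 : x) = R / (y)`, so `x` and `y` swap roles.
    refine ih hy hx hyx hxy (LinearMap.toSpanSingleton R (LinearMap.ker g) ⟨x, hxK⟩) ?_ ?_ hK
    · rintro ⟨w, hw⟩
      obtain ⟨c, rfl⟩ := Ideal.mem_span_singleton.1 (hker ▸ hw)
      exact ⟨c, Subtype.ext (mul_comm c x)⟩
    · rw [← hxy]
      ext c
      rw [mem_annIdeal, LinearMap.mem_ker, Subtype.ext_iff]
      rfl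

end Periodic

/-- The module `A ⧸ (a)` is finitely presented. -/
lemma isNPresented_one_quotient_span_singleton {A : Type u} [CommRing A] (a : A) :
    IsNPresented A 1 (A ⧸ Ideal.span {a}) := by
  let e : (Fin 1 → A) ≃ₗ[A] A := LinearEquiv.funUnique (Fin 1) A A
  refine ⟨fun _ ↦ 1, fun _ ↦ LinearMap.lsmul A _ a, (Ideal.span {a}).mkQ ∘ₗ e.toLinearMap,
    (Submodule.mkQ_surjective _).comp e.surjective, fun _ x ↦ ?_, fun i hi ↦ by omega⟩
  rw [LinearMap.comp_apply, ← LinearMap.mem_ker, Submodule.ker_mkQ, Ideal.mem_span_singleton]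
  constructor
  · rintro ⟨c, hc⟩
    exact ⟨e.symm c, e.injective (by simpa using hc.symm)⟩
  · rintro ⟨c, rfl⟩
    exact ⟨e c, by simp⟩

/-- Up to a unit `x` is the image of some `a` in `A`, so `A / (a)` localizes to the quotient by
`(x)`; localizing preserves bounds on projective dimension. -/
lemma IsArithmeticalRing.not_isNDRing_one {A : Type u} [CommRing A] (hA : IsArithmeticalRing A)
    (m : Ideal A) [m.IsMaximal] (x : Localization.AtPrime m) (hx : x ≠ 0)
    (hxd : IsZeroDivisor x) (hfg : (annIdeal x).FG) (d : ℕ) : ¬ IsNDRing A 1 d := by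
  intro hd
  have := hA.preValuationRing_localization m
  obtain ⟨y, hxy⟩ := PreValuationRing.exists_eq_span_singleton hfg
  have hy : y ≠ 0 := by
    rintro rfl
    obtain ⟨z, hz, hxz⟩ := hxd
    have : z ∈ annIdeal x := mem_annIdeal.2 (by rw [mul_comm, hxz])
    rw [hxy] at this
    exact hz (by simpa using this)
  have hyx := PreValuationRing.annIdeal_eq_span_of_annIdeal_eq_span hx hy hxy
  obtain ⟨a, s, hs⟩ := IsLocalization.exists_mk'_eq m.primeCompl x
  have hspan : Ideal.span {algebraMap A (Localization.AtPrime m) a} = Ideal.span {x} := by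
    have h := IsLocalization.associated_mk'_algebraMap (B := Localization.AtPrime m) a s
    rw [hs] at h
    exact le_antisymm (Ideal.span_singleton_le_span_singleton.2 h.dvd)
      (Ideal.span_singleton_le_span_singleton.2 h.symm.dvd)
  let Q := ModuleCat.of A (A ⧸ Ideal.span {a})
  have hQ : HasProjectiveDimensionLE Q d := (projectiveDimension_le_iff _ d).1
    (hd _ (isNPresented_one_quotient_span_singleton a))
  have hL := ModuleCat.localizedModule_hasProjectiveDimensionLE d m.primeCompl Q
  let q : A →ₗ[A] Q := (Ideal.span {a}).mkQ
  let ι := Algebra.linearMap A (Localization.AtPrime m)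
  let κ := Q.localizedModuleMkLinearMap m.primeCompl
  have : IsLocalizedModule m.primeCompl κ := ModuleCat.localizedModule_isLocalizedModule Q _
  let g := IsLocalizedModule.mapExtendScalars m.primeCompl ι κ (Localization.AtPrime m) q
  refine ModuleCat.not_hasProjectiveDimensionLE_of_annIdeal_eq_span d hx hy hxy hyx
    (N := Q.localizedModule m.primeCompl) g ?_ ?_ hL
  · exact IsLocalizedModule.map_surjective m.primeCompl ι κ q (Submodule.mkQ_surjective _)
  · have hex : Function.Exact (LinearMap.lsmul A A a) q := by
      intro c
      rw [← LinearMap.mem_ker, Submodule.ker_mkQ, Ideal.mem_span_singleton]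
      exact ⟨fun ⟨t, ht⟩ ↦ ⟨t, ht.symm⟩, fun ⟨t, ht⟩ ↦ ⟨t, ht.symm⟩⟩
    have hex' := IsLocalizedModule.map_exact m.primeCompl ι ι κ _ _ hex
    have hmap : IsLocalizedModule.map m.primeCompl ι ι (LinearMap.lsmul A A a) =
        LinearMap.lsmul A (Localization.AtPrime m) a := by
      refine IsLocalizedModule.ext m.primeCompl ι (IsLocalizedModule.map_units ι) ?_
      ext
      simp [ι, IsLocalizedModule.map_comp, Algebra.smul_def]
    rw [hmap] at hex'
    rw [← hspan]
    ext c
    rw [LinearMap.mem_ker, Ideal.mem_span_singleton]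
    refine (hex' c).trans ⟨fun ⟨t, ht⟩ ↦ ⟨t, ?_⟩, fun ⟨t, ht⟩ ↦ ⟨t, ?_⟩⟩
    · rw [← ht, LinearMap.lsmul_apply, Algebra.smul_def]
    · rw [ht, LinearMap.lsmul_apply, Algebra.smul_def]

theorem proposition3p8 (A : Type u) [CommRing A] (hA : IsArithmeticalRing A) :
    ((∀ (m : Ideal A) [m.IsMaximal] (x : Localization.AtPrime m),
        x ≠ 0 → IsZeroDivisor x → ¬ (annIdeal x).FG) →
      IsNDRing A 3 1) ∧
    ((∃ (m : Ideal A) (_ : m.IsMaximal) (x : Localization.AtPrime m),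
        x ≠ 0 ∧ IsZeroDivisor x ∧ (annIdeal x).FG) →
      ∀ d : ℕ, ¬ IsNDRing A 1 d) :=
  ⟨hA.isNDRing_three_one, fun ⟨m, _, x, hx, hxd, hfg⟩ d ↦
    hA.not_isNDRing_one m x hx hxd hfg d⟩
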